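/- Let $\mathbb{K}=\mathbb{R}$ or $\mathbb{C}$, and let all Banach spaces and linear operators be over $\mathbb{K}$. Let $\mathbb{D}$ be the open unit disc of $\mathbb{C}$, let $\mathcal{L}(X,Y)$ be the space of bounded linear operators from $X$ to $Y$ with the operator norm, and for a Banach space $E$ let $h^\infty(\mathbb{D},E)$ be the space of bounded harmonic functions $f:\mathbb{D}\to E$. A bounded linear operator $T:E\to F$ between Banach spaces is called a *Radon–Nikodym operator* if for every $f\in h^\infty(\mathbb{D},E)$ and almost every $t\in[0,2\pi]$ (for Lebesgue measure), $T(f(re^{it}))$ converges in the norm of $F$ as $r\to1^-$. A Banach space $E$ has the *Radon–Nikodym property* if the identity of $E$ is a Radon–Nikodym operator. A bounded linear operator $V:E\to F$ between Banach spaces is called *weakly LUR* if for every $x\in E$ and every bounded sequence $(x_n)_{n\ge1}$ in $E$ such that $$\frac{\|x_n\|^2}{2}+\frac{\|x\|^2}{2}-\left\|\frac{x_n+x}{2}\right\|^2\longrightarrow 0\qquad(n\to\infty),$$ one has $V(x_n)\to V(x)$ weakly in $F$. **Theorem.** Let $X,Y,Z$ be Banach spaces such that $X$ is separable and $Y$ has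 the Radon–Nikodym property, and let $V:\mathcal{L}(X,Y)\to Z$ be a weakly LUR operator. Then $V$ is a Radon–Nikodym operator. -/

import Mathlib

/-- The real normed space underlying a normed space over `𝕜` (`𝕜` is `ℝ` or `ℂ`) is used to speak of
harmonic functions with values in `E`.  `MemHardyInfty 𝕜 f` says that the restriction of `f` to the
open unit disc is a bounded harmonic function, that is, an element of `h^∞(𝔻, E)`.
Only the values of `f` on the open unit disc matter. -/
def MemHardyInfty (𝕜 : Type*) [RCLike 𝕜] {E : Type*} [NormedAddCommGroup E] [NormedSpace 𝕜 E]
    (f : ℂ → E) : Prop :=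
  letI : NormedSpace ℝ E := NormedSpace.restrictScalars ℝ 𝕜 E
  InnerProductSpace.HarmonicOnNhd f (Metric.ball (0 : ℂ) 1) ∧
    ∃ C : ℝ, ∀ z ∈ Metric.ball (0 : ℂ) 1, ‖f z‖ ≤ C

/-- `T` is a Radon–Nikodym operator: for every bounded harmonic `f` on the unit disc, `T (f (r e^{it}))`
converges in norm as `r → 1⁻`, for almost every `t` of the torus, parametrised by `(0, 2π]`. -/
def IsRadonNikodymOperator {𝕜 : Type*} [RCLike 𝕜] {E F : Type*}
    [NormedAddCommGroup E] [NormedSpace 𝕜 E] [NormedAddCommGroup F] [NormedSpace 𝕜 F]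
    (T : E →L[𝕜] F) : Prop :=
  ∀ f : ℂ → E, MemHardyInfty 𝕜 f →
    ∀ᵐ t : ℝ ∂(MeasureTheory.volume.restrict (Set.Ioc 0 (2 * Real.pi))),
      ∃ y : F, Filter.Tendsto (fun r : ℝ => T (f ((r : ℂ) * Complex.exp ((t : ℂ) * Complex.I))))
        (nhdsWithin 1 (Set.Iio 1)) (nhds y)

/-- The Radon–Nikodym property: the identity is a Radon–Nikodym operator. -/
def HasRadonNikodymProperty (𝕜 : Type*) [RCLike 𝕜] (E : Type*)
    [NormedAddCommGroup E] [NormedSpace 𝕜 E] : Prop :=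
  IsRadonNikodymOperator (ContinuousLinearMap.id 𝕜 E)

/-- `V` is a weakly LUR operator. -/
def IsWeaklyLUROperator {𝕜 : Type*} [RCLike 𝕜] {E F : Type*}
    [NormedAddCommGroup E] [NormedSpace 𝕜 E] [NormedAddCommGroup F] [NormedSpace 𝕜 F]
    (V : E →L[𝕜] F) : Prop :=
  ∀ (x : E) (u : ℕ → E), Bornology.IsBounded (Set.range u) →
    Filter.Tendsto
      (fun n => ‖u n‖ ^ 2 / 2 + ‖x‖ ^ 2 / 2 - ‖(2 : 𝕜)⁻¹ • (u n + x)‖ ^ 2)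
      Filter.atTop (nhds 0) →
    Filter.Tendsto (fun n => toWeakSpace 𝕜 F (V (u n))) Filter.atTop (nhds (toWeakSpace 𝕜 F (V x)))

/-!
Let `f` be a bounded harmonic function on the unit disc with values in the operators from `X` to
`Y`.  For each `x` the function `z ↦ f z x` has radial limits almost everywhere because `Y` has the
Radon–Nikodym property; since `X` is separable and `f` is bounded, for almost every `t` the
operators `f (r e^{it})` converge strongly, as `r → 1⁻`, to an operator `T t`
(`exists_ae_strong_radial_limit`).

The norm of a bounded harmonic function is at most the Poisson integral of any bounded measurable
function that dominates its radial limits on a norming family of functionals, and by Fatou's theorem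
(`ae_tendsto_poissonIntegral`) this Poisson integral has that function as its radial limit; this is
`ae_eventually_norm_le_add`.  Applied to `t ↦ ‖T t‖`, it gives `limsup ‖f (r e^{it})‖ ≤ ‖T t‖`
(`ae_eventually_opNorm_le_add`).  As the operator norm is lower semicontinuous for strong
convergence, both `‖f (r e^{it})‖` and `‖(f (r e^{it}) + T t) / 2‖` tend to `‖T t‖`, so the weakly
LUR property makes `V (f (r e^{it}))` converge weakly to `V (T t)`.

Finally, the same domination principle upgrades weak radial limits of a bounded harmonic function
`g` to norm limits (`ae_tendsto_of_ae_tendsto_weak`).  If `b` is the weak limit, then for all `z` in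
a countable dense subset of the closed span of the range of `g` one has
`limsup ‖g (r e^{it}) - z‖ ≤ ‖b t - z‖` almost everywhere, and `z` can be taken close to `b t`.
This replaces the representation of `g` as a Bochner–Poisson integral of `b`, so that Fatou's theorem
is needed for real functions only.
-/

open MeasureTheory Filter Set Topology Metric

/-! ### Poisson integrals and radial limits of bounded harmonic functions -/

/-- The Poisson integral at the point `w` of the unit disc of a function `m` on the unit circle, the
circle being parametrised by the angle in `(0, 2π]`. -/
noncomputable def poissonIntegral (m : ℝ → ℝ) (w : ℂ) : ℝ :=
  (2 * Real.pi)⁻¹ * ∫ θ in Ioc 0 (2 * Real.pi), poissonKernel 0 w (circleMap 0 1 θ) * m θ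

lemma poissonKernel_circleMap_nonneg {w : ℂ} (hw : w ∈ ball (0 : ℂ) 1) (θ : ℝ) :
    0 ≤ poissonKernel 0 w (circleMap 0 1 θ) := by
  have : ‖w‖ < 1 := by simpa using hw
  rw [poissonKernel_def]
  apply div_nonneg _ (by positivity)
  simp only [sub_zero, norm_circleMap_zero, abs_one]
  nlinarith [norm_nonneg w]

lemma continuous_poissonKernel_circleMap {w : ℂ} (hw : w ∈ ball (0 : ℂ) 1) :
    Continuous fun θ : ℝ => poissonKernel 0 w (circleMap 0 1 θ) := by
  simp only [poissonKernel_def]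
  refine Continuous.div (by fun_prop) (by fun_prop) fun θ => ?_
  have : circleMap 0 1 θ - w ≠ 0 := sub_ne_zero.2 (circleMap_ne_mem_ball hw θ)
  simpa using this

lemma integrableOn_poissonKernel {w : ℂ} (hw : w ∈ ball (0 : ℂ) 1) :
    IntegrableOn (fun θ => poissonKernel 0 w (circleMap 0 1 θ)) (Ioc 0 (2 * Real.pi)) :=
  ((continuous_poissonKernel_circleMap hw).integrableOn_Icc).mono_set Ioc_subset_Icc_self

lemma integrableOn_poissonKernel_mul {w : ℂ} (hw : w ∈ ball (0 : ℂ) 1) {m : ℝ → ℝ}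
    (hm : AEMeasurable m (volume.restrict (Ioc 0 (2 * Real.pi)))) {M : ℝ} (hM : ∀ t, |m t| ≤ M) :
    IntegrableOn (fun θ => poissonKernel 0 w (circleMap 0 1 θ) * m θ) (Ioc 0 (2 * Real.pi)) :=
  (integrableOn_poissonKernel hw).mul_bdd hm.aestronglyMeasurable (Eventually.of_forall hM)

/-- The Poisson integral formula on the circle of radius `r < 1`, transported to the unit circle by
homogeneity of the Poisson kernel. -/
lemma poissonIntegral_comp_circleMap {u : ℂ → ℝ}
    (hu : InnerProductSpace.HarmonicOnNhd u (ball 0 1)) {w : ℂ} (hw : w ∈ ball (0 : ℂ) 1)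
    {r : ℝ} (hr0 : 0 < r) (hr1 : r < 1) :
    poissonIntegral (fun θ => u (circleMap 0 r θ)) w = u (r * w) := by
  have hw' : (r : ℂ) * w ∈ ball (0 : ℂ) r := by
    have : ‖w‖ < 1 := by simpa using hw
    simp [abs_of_pos hr0]
    nlinarith
  rw [← (hu.mono (closedBall_subset_ball hr1)).circleAverage_poissonKernel_smul hw']
  rw [Real.circleAverage_def, poissonIntegral,
    intervalIntegral.integral_of_le (by positivity), smul_eq_mul]
  congr 2
  ext θ
  have h1 : circleMap 0 r θ = r * circleMap 0 1 θ := by simp [circleMap]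
  have h2 : (r : ℂ) * circleMap 0 1 θ - r * w = r * (circleMap 0 1 θ - w) := by ring
  simp only [Pi.smul_apply', smul_eq_mul, poissonKernel_def, sub_zero, h1, h2, norm_mul, mul_pow,
    Complex.norm_real]
  rw [← mul_sub, mul_div_mul_left _ _ (by simp [hr0.ne'])]

lemma poissonIntegral_const {w : ℂ} (hw : w ∈ ball (0 : ℂ) 1) (c : ℝ) :
    poissonIntegral (fun _ => c) w = c :=
  poissonIntegral_comp_circleMap (u := fun _ => c) (InnerProductSpace.harmonicOnNhd_const c)
    hw (r := 1 / 2) (by norm_num) (by norm_num)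

lemma circleMap_mem_unitBall {r : ℝ} (hr0 : 0 < r) (hr1 : r < 1) (t : ℝ) :
    circleMap 0 r t ∈ ball (0 : ℂ) 1 := by
  simpa [abs_of_pos hr0] using hr1

lemma eventually_mem_Ioo_half_one : ∀ᶠ r : ℝ in 𝓝[<] 1, r ∈ Ioo (1 / 2 : ℝ) 1 :=
  Ioo_mem_nhdsLT (by norm_num)

lemma continuous_comp_circleMap {E : Type*} [TopologicalSpace E] {u : ℂ → E}
    (hu : ContinuousOn u (ball 0 1)) {r : ℝ} (hr : r ∈ Ioo (1 / 2 : ℝ) 1) :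
    Continuous fun t => u (circleMap 0 r t) :=
  hu.comp_continuous (continuous_circleMap 0 r)
    fun t => circleMap_mem_unitBall (by linarith [hr.1]) hr.2 t

lemma aemeasurable_of_tendsto_circleMap {u : ℂ → ℝ} (hu : ContinuousOn u (ball 0 1)) {b : ℝ → ℝ}
    {μ : Measure ℝ}
    (hb : ∀ᵐ t ∂μ, Tendsto (fun r : ℝ => u (circleMap 0 r t)) (𝓝[<] 1) (𝓝 (b t))) :
    AEMeasurable b μ := by
  obtain ⟨s, hs⟩ := exists_seq_tendsto (𝓝[<] (1 : ℝ))
  obtain ⟨N, hN⟩ := eventually_atTop.1 (hs.eventually eventually_mem_Ioo_half_one)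
  refine aemeasurable_of_tendsto_metrizable_ae atTop
    (f := fun n t => u (circleMap 0 (s (n + N)) t))
    (fun n => (continuous_comp_circleMap hu (hN _ (by omega))).aemeasurable) ?_
  filter_upwards [hb] with t ht
  exact (ht.comp hs).comp (tendsto_add_atTop_nat N)

/-- A bounded harmonic function is dominated by the Poisson integral of any bounded measurable
function that dominates its radial limits. -/
lemma le_poissonIntegral {u : ℂ → ℝ} (hu : InnerProductSpace.HarmonicOnNhd u (ball 0 1))
    {C : ℝ} (hC : ∀ z ∈ ball (0 : ℂ) 1, |u z| ≤ C) {m : ℝ → ℝ}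
    (hm : AEMeasurable m (volume.restrict (Ioc 0 (2 * Real.pi)))) {M : ℝ} (hM : ∀ t, |m t| ≤ M)
    (hlim : ∀ᵐ t ∂(volume.restrict (Ioc 0 (2 * Real.pi))),
      ∃ b ≤ m t, Tendsto (fun r : ℝ => u (circleMap 0 r t)) (𝓝[<] 1) (𝓝 b))
    {w : ℂ} (hw : w ∈ ball (0 : ℂ) 1) : u w ≤ poissonIntegral m w := by
  classical
  let b : ℝ → ℝ := fun t =>
    if h : ∃ b ≤ m t, Tendsto (fun r : ℝ => u (circleMap 0 r t)) (𝓝[<] 1) (𝓝 b)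
      then h.choose else 0
  have hb : ∀ᵐ t ∂(volume.restrict (Ioc 0 (2 * Real.pi))),
      b t ≤ m t ∧ Tendsto (fun r : ℝ => u (circleMap 0 r t)) (𝓝[<] 1) (𝓝 (b t)) := by
    filter_upwards [hlim] with t ht
    simp only [b, dif_pos ht]
    exact ht.choose_spec
  have hCb : ∀ᵐ t ∂(volume.restrict (Ioc 0 (2 * Real.pi))), ‖b t‖ ≤ C := by
    filter_upwards [hb] with t ht
    refine le_of_tendsto ht.2.norm ?_
    filter_upwards [eventually_mem_Ioo_half_one] with r hr
    exact hC _ (circleMap_mem_unitBall (by linarith [hr.1]) hr.2 t)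
  have hbm : AEStronglyMeasurable b (volume.restrict (Ioc 0 (2 * Real.pi))) :=
    (aemeasurable_of_tendsto_circleMap hu.continuousOn
      (hb.mono fun _ h => h.2)).aestronglyMeasurable
  have hK := integrableOn_poissonKernel hw
  -- both sides of the Poisson formula on the circle of radius `r` converge as `r → 1⁻`
  have hlim1 : Tendsto (fun r : ℝ => poissonIntegral (fun θ => u (circleMap 0 r θ)) w) (𝓝[<] 1)
      (𝓝 (poissonIntegral b w)) := by
    refine Tendsto.const_mul _ ?_
    refine tendsto_integral_filter_of_dominated_convergence
      (fun θ => poissonKernel 0 w (circleMap 0 1 θ) * C) ?_ ?_ (hK.mul_const C) ?_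
    · filter_upwards [eventually_mem_Ioo_half_one] with r hr
      exact ((continuous_poissonKernel_circleMap hw).mul
        (continuous_comp_circleMap hu.continuousOn hr)).aestronglyMeasurable
    · filter_upwards [eventually_mem_Ioo_half_one] with r hr
      refine Eventually.of_forall fun θ => ?_
      rw [norm_mul, Real.norm_of_nonneg (poissonKernel_circleMap_nonneg hw θ)]
      exact mul_le_mul_of_nonneg_left
        (hC _ (circleMap_mem_unitBall (by linarith [hr.1]) hr.2 θ))
        (poissonKernel_circleMap_nonneg hw θ)
    · filter_upwards [hb] with θ hθ
      exact hθ.2.const_mul _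
  have hlim2 : Tendsto (fun r : ℝ => poissonIntegral (fun θ => u (circleMap 0 r θ)) w) (𝓝[<] 1)
      (𝓝 (u w)) := by
    have h1 : Tendsto (fun r : ℝ => u (r * w)) (𝓝[<] 1) (𝓝 (u w)) := by
      have h2 : ContinuousAt u w := hu.continuousOn.continuousAt (isOpen_ball.mem_nhds hw)
      have h3 : Tendsto (fun r : ℝ => (r : ℂ) * w) (𝓝[<] 1) (𝓝 w) := by
        have : Continuous fun r : ℝ => (r : ℂ) * w := by fun_prop
        simpa using (this.tendsto 1).mono_left nhdsWithin_le_nhds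
      exact h2.tendsto.comp h3
    refine h1.congr' ?_
    filter_upwards [eventually_mem_Ioo_half_one] with r hr
    exact (poissonIntegral_comp_circleMap hu hw (by linarith [hr.1]) hr.2).symm
  rw [tendsto_nhds_unique hlim2 hlim1]
  refine mul_le_mul_of_nonneg_left ?_ (by positivity)
  refine integral_mono_ae (hK.mul_bdd hbm hCb) (integrableOn_poissonKernel_mul hw hm hM) ?_
  filter_upwards [hb] with θ hθ
  exact mul_le_mul_of_nonneg_left hθ.1 (poissonKernel_circleMap_nonneg hw θ)

/-! ### Fatou's theorem for Poisson integrals -/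

lemma norm_circleMap_one_sub_circleMap_sq (r t θ : ℝ) :
    ‖circleMap 0 1 θ - circleMap 0 r t‖ ^ 2
      = (1 - r) ^ 2 + 4 * r * Real.sin ((θ - t) / 2) ^ 2 := by
  have h1 : Real.cos (θ - t) = 1 - 2 * Real.sin ((θ - t) / 2) ^ 2 := by
    have := Real.cos_two_mul ((θ - t) / 2)
    rw [show 2 * ((θ - t) / 2) = θ - t by ring] at this
    nlinarith [Real.sin_sq_add_cos_sq ((θ - t) / 2)]
  rw [← Complex.normSq_eq_norm_sq, Complex.normSq_apply]
  rw [Real.cos_sub] at h1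
  simp only [circleMap, zero_add, Complex.exp_mul_I, Complex.sub_re, Complex.sub_im,
    Complex.mul_re, Complex.mul_im, Complex.add_re, Complex.add_im, Complex.ofReal_re,
    Complex.ofReal_im, Complex.cos_ofReal_re, Complex.cos_ofReal_im, Complex.sin_ofReal_re,
    Complex.sin_ofReal_im, Complex.I_re, Complex.I_im]
  linear_combination (-2 * r) * h1 + Real.sin_sq_add_cos_sq θ + r ^ 2 * Real.sin_sq_add_cos_sq t

lemma exists_mul_abs_le_abs_sin {b : ℝ} (hb0 : 0 < b) (hb : b < Real.pi) :
    ∃ a > 0, ∀ x : ℝ, |x| ≤ b → a * |x| ≤ |Real.sin x| := by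
  refine ⟨Real.sin b / b, div_pos (Real.sin_pos_of_pos_of_lt_pi hb0 hb) hb0, fun x hx => ?_⟩
  have hxb : 0 ≤ 1 - |x| / b := by rwa [sub_nonneg, div_le_one hb0]
  have h1 := strictConcaveOn_sin_Icc.concaveOn.2 ⟨hb0.le, hb.le⟩ ⟨le_rfl, Real.pi_pos.le⟩
    (by positivity : 0 ≤ |x| / b) hxb (by ring)
  have h2 : |x| / b * b = |x| := div_mul_cancel₀ _ hb0.ne'
  simp only [smul_eq_mul, Real.sin_zero, mul_zero, add_zero, h2] at h1
  have h3 : Real.sin |x| ≤ |Real.sin x| := by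
    rcases abs_cases x with ⟨h, -⟩ | ⟨h, -⟩ <;> rw [h]
    · exact le_abs_self _
    · rw [Real.sin_neg]; exact neg_le_abs _
  calc Real.sin b / b * |x| = |x| / b * Real.sin b := by ring
    _ ≤ _ := h1.trans h3

/-- The Poisson kernel along the radius at an interior angle `t` is dominated by a rescaled Cauchy
density on the whole interval of angles.  The constant depends on `t` since the two ends of the
interval parametrise neighbouring points of the circle. -/
lemma exists_poissonKernel_le {t : ℝ} (ht : t ∈ Ioo 0 (2 * Real.pi)) :
    ∃ c > 0, ∀ r ∈ Ioo (1 / 2 : ℝ) 1, ∀ θ ∈ Ioc 0 (2 * Real.pi),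
      poissonKernel 0 (circleMap 0 r t) (circleMap 0 1 θ)
        ≤ c * ((1 - r) / ((1 - r) ^ 2 + (θ - t) ^ 2)) := by
  obtain ⟨a, ha, hsin⟩ := exists_mul_abs_le_abs_sin (b := max t (2 * Real.pi - t) / 2)
    (by have := le_max_left t (2 * Real.pi - t); linarith [ht.1])
    (by have : max t (2 * Real.pi - t) < 2 * Real.pi := max_lt ht.2 (by linarith [ht.1])
        linarith)
  refine ⟨2 / min 1 (a ^ 2 / 2), by positivity, fun r hr θ hθ => ?_⟩
  have h1 : |(θ - t) / 2| ≤ max t (2 * Real.pi - t) / 2 := by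
    rw [abs_div, abs_two]
    gcongr
    rcases abs_cases (θ - t) with ⟨h, -⟩ | ⟨h, -⟩ <;> rw [h]
    · exact le_max_of_le_right (by linarith [hθ.2])
    · exact le_max_of_le_left (by linarith [hθ.1])
  have h2 := hsin _ h1
  have h3 : a ^ 2 * ((θ - t) / 2) ^ 2 ≤ Real.sin ((θ - t) / 2) ^ 2 := by
    rw [← sq_abs (Real.sin _), ← sq_abs ((θ - t) / 2), ← mul_pow]
    gcongr
  have hr0 : 0 < 1 - r := by linarith [hr.2]
  have h4 : min 1 (a ^ 2 / 2) * ((1 - r) ^ 2 + (θ - t) ^ 2)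
      ≤ (1 - r) ^ 2 + 4 * r * Real.sin ((θ - t) / 2) ^ 2 := by
    have h5 : min 1 (a ^ 2 / 2) * (1 - r) ^ 2 ≤ 1 * (1 - r) ^ 2 := by
      gcongr; exact min_le_left _ _
    have h6 : min 1 (a ^ 2 / 2) * (θ - t) ^ 2 ≤ (a ^ 2 / 2) * (θ - t) ^ 2 := by
      gcongr; exact min_le_right _ _
    nlinarith [mul_nonneg (by linarith [hr.1] : (0 : ℝ) ≤ 4 * r - 2)
      (sq_nonneg (Real.sin ((θ - t) / 2)))]
  have hp : 0 < min 1 (a ^ 2 / 2) := by positivity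
  rw [poissonKernel_def, sub_zero, sub_zero, norm_circleMap_one_sub_circleMap_sq,
    norm_circleMap_zero, norm_circleMap_zero, abs_one, sq_abs, div_mul_div_comm]
  apply div_le_div₀ (by positivity) _ (by positivity) h4
  nlinarith [hr.1, hr.2]

/-- A Cauchy density of width `h` is dominated by a sum of normalised indicators of dyadic dilates
of the interval of radius `h`. -/
lemma div_sq_add_sq_le_sum_dyadic {h s : ℝ} (hh : 0 < h) {N : ℕ} (hN : |s| ≤ 2 ^ N * h) :
    h / (h ^ 2 + s ^ 2)
      ≤ ∑ k ∈ Finset.range (N + 1), if |s| ≤ 2 ^ k * h then 4 * (1 / 4) ^ k / h else 0 := by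
  classical
  have hex : ∃ k : ℕ, |s| ≤ 2 ^ k * h := ⟨N, hN⟩
  have hk := Nat.find_spec hex
  have hkN : Nat.find hex ≤ N := Nat.find_min' hex hN
  refine le_trans ?_ (Finset.single_le_sum
    (f := fun k => if |s| ≤ 2 ^ k * h then 4 * (1 / 4 : ℝ) ^ k / h else 0)
    (fun k _ => by positivity) (Finset.mem_range.2 (Nat.lt_succ_of_le hkN)))
  simp only [if_pos hk]
  rcases Nat.eq_zero_or_pos (Nat.find hex) with h0 | h0
  · rw [h0, pow_zero, mul_one, div_le_div_iff₀ (by positivity) hh]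
    nlinarith [sq_nonneg s, sq_nonneg h]
  · obtain ⟨j, hj⟩ := Nat.exists_eq_succ_of_ne_zero h0.ne'
    have h1 : 2 ^ j * h < |s| := not_le.1 (Nat.find_min hex (m := j) (by omega))
    have h2 : (2 ^ j * h) ^ 2 < s ^ 2 := by
      rw [← sq_abs s]
      gcongr
    have h3 : (4 : ℝ) ^ j = (2 ^ j) ^ 2 := by
      rw [← pow_mul, mul_comm, pow_mul]; norm_num
    have h4 : 4 * (1 / 4 : ℝ) ^ (j + 1) = 1 / (2 ^ j) ^ 2 := by
      rw [← h3, pow_succ, one_div_pow]; ring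
    rw [hj, Nat.succ_eq_add_one, h4, div_div, div_le_div_iff₀ (by positivity) (by positivity)]
    nlinarith [sq_nonneg h]

/-- Fatou's theorem for bounded measurable functions: the Poisson integral converges radially to
the function almost everywhere.  The point `t` is a Lebesgue point, and the averages of
`|m - m t|` over the dyadic dilates of the interval of radius `1 - r` are summed with weights
`2⁻ᵏ`. -/
theorem ae_tendsto_poissonIntegral {m : ℝ → ℝ}
    (hm : AEMeasurable m (volume.restrict (Ioc 0 (2 * Real.pi)))) {M : ℝ} (hM : ∀ t, |m t| ≤ M) :
    ∀ᵐ t ∂(volume.restrict (Ioc 0 (2 * Real.pi))),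
      Tendsto (fun r : ℝ => poissonIntegral m (circleMap 0 r t)) (𝓝[<] 1) (𝓝 (m t)) := by
  set I : Set ℝ := Ioc 0 (2 * Real.pi) with hI
  have hM0 : 0 ≤ M := (abs_nonneg _).trans (hM 0)
  -- extension by zero, so that the Lebesgue differentiation theorem on `ℝ` applies
  let g : ℝ → ℝ := I.indicator m
  have hg : ∀ t, |g t| ≤ M := fun t => by
    by_cases ht : t ∈ I
    · simpa [g, ht] using hM t
    · simpa [g, ht] using hM0
  have hgm : AEStronglyMeasurable g volume :=
    ((aemeasurable_indicator_iff measurableSet_Ioc).2 hm).aestronglyMeasurable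
  have hgl : LocallyIntegrable g volume :=
    (locallyIntegrable_const M).mono hgm (Eventually.of_forall fun t => by
      simpa [abs_of_nonneg hM0] using hg t)
  have hleb := ae_restrict_of_ae (s := I)
    (IsUnifLocDoublingMeasure.ae_tendsto_average_norm_sub volume hgl 1)
  -- the kernel bound is available at interior angles only
  have hne : ∀ᵐ t ∂(volume.restrict I), t ≠ 2 * Real.pi :=
    ae_restrict_of_ae (by simp [ae_iff])
  filter_upwards [hleb, hne, ae_restrict_mem measurableSet_Ioc] with t htl htne htI
  have ht : t ∈ Ioo 0 (2 * Real.pi) := ⟨htI.1, lt_of_le_of_ne htI.2 htne⟩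
  let A : ℝ → ℝ := fun ρ => ⨍ y in closedBall t ρ, ‖g y - g t‖
  have hA : Tendsto A (𝓝[>] 0) (𝓝 0) :=
    htl (fun _ => t) (fun ρ => ρ) tendsto_id (by
      filter_upwards [self_mem_nhdsWithin] with ρ hρ
      exact mem_closedBall_self (by simpa using (le_of_lt hρ)))
  have hφm : AEStronglyMeasurable (fun y => ‖g y - g t‖) volume :=
    (hgm.sub aestronglyMeasurable_const).norm
  have hφb : ∀ y, ‖g y - g t‖ ≤ 2 * M := fun y =>
    (norm_sub_le _ _).trans (by simpa [two_mul] using add_le_add (hg y) (hg t))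
  have hφi : ∀ ρ, IntegrableOn (fun y => ‖g y - g t‖) (closedBall t ρ) := fun ρ =>
    Measure.integrableOn_of_bounded measure_closedBall_lt_top.ne hφm
      (Eventually.of_forall fun y => by simpa using hφb y)
  have hAint : ∀ ρ > 0, ∫ y in closedBall t ρ, ‖g y - g t‖ = 2 * ρ * A ρ := fun ρ hρ => by
    change _ = 2 * ρ * ⨍ y in closedBall t ρ, ‖g y - g t‖
    rw [setAverage_eq, smul_eq_mul, Real.volume_real_closedBall hρ.le, mul_inv_cancel_left₀]
    positivity
  have hA0 : ∀ ρ > 0, 0 ≤ A ρ := fun ρ hρ => by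
    have h1 := hAint ρ hρ
    have h2 : 0 ≤ ∫ y in closedBall t ρ, ‖g y - g t‖ := integral_nonneg fun _ => norm_nonneg _
    rw [h1] at h2
    exact nonneg_of_mul_nonneg_right h2 (by positivity)
  have hAM : ∀ ρ > 0, A ρ ≤ 2 * M := fun ρ hρ => by
    have h1 := hAint ρ hρ
    have h2 : ∫ y in closedBall t ρ, ‖g y - g t‖ ≤ ∫ y in closedBall t ρ, 2 * M :=
      integral_mono (hφi ρ) (integrableOn_const measure_closedBall_lt_top.ne) hφb
    rw [h1, setIntegral_const, smul_eq_mul, Real.volume_real_closedBall hρ.le] at h2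
    exact le_of_mul_le_mul_left h2 (by positivity)
  obtain ⟨c, hc, hker⟩ := exists_poissonKernel_le ht
  -- the weighted sum of the dyadic averages tends to zero
  have hbound : ∀ h > 0, ∀ k : ℕ, ‖(1 / 2 : ℝ) ^ k * A (2 ^ k * h)‖ ≤ (1 / 2) ^ k * (2 * M) :=
    fun h hh k => by
      rw [norm_mul, Real.norm_of_nonneg (by positivity),
        Real.norm_of_nonneg (hA0 _ (by positivity))]
      exact mul_le_mul_of_nonneg_left (hAM _ (by positivity)) (by positivity)
  have hsummable : Summable fun k : ℕ => (1 / 2 : ℝ) ^ k * (2 * M) :=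
    summable_geometric_two.mul_right _
  have hsum : Tendsto (fun r : ℝ => ∑' k : ℕ, (1 / 2 : ℝ) ^ k * A (2 ^ k * (1 - r)))
      (𝓝[<] 1) (𝓝 0) := by
    have h0 : (0 : ℝ) = ∑' k : ℕ, (1 / 2 : ℝ) ^ k * 0 := by simp
    rw [h0]
    refine tendsto_tsum_of_dominated_convergence hsummable (fun k => ?_) ?_
    · refine Tendsto.const_mul _ (hA.comp ?_)
      refine tendsto_nhdsWithin_iff.2 ⟨?_, ?_⟩
      · have : Continuous fun r : ℝ => 2 ^ k * (1 - r) := by fun_prop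
        simpa using (this.tendsto 1).mono_left nhdsWithin_le_nhds
      · filter_upwards [self_mem_nhdsWithin] with r hr
        have : 0 < 1 - r := sub_pos.2 hr
        exact mem_Ioi.2 (by positivity)
    · filter_upwards [self_mem_nhdsWithin] with r hr k
      exact hbound _ (sub_pos.2 hr) k
  have hsum' := hsum.const_mul ((2 * Real.pi)⁻¹ * (c * 8))
  rw [mul_zero] at hsum'
  rw [tendsto_iff_norm_sub_tendsto_zero]
  refine squeeze_zero' (Eventually.of_forall fun _ => norm_nonneg _) ?_ hsum'
  filter_upwards [eventually_mem_Ioo_half_one] with r hr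
  have hh : 0 < 1 - r := by linarith [hr.2]
  have hw : circleMap 0 r t ∈ ball (0 : ℂ) 1 := circleMap_mem_unitBall (by linarith [hr.1]) hr.2 t
  -- the dilate by `2 ^ N` of the interval of radius `1 - r` about `t` contains all angles
  obtain ⟨N, hN⟩ : ∃ N : ℕ, 2 * Real.pi / (1 - r) < 2 ^ N := pow_unbounded_of_one_lt _ one_lt_two
  rw [div_lt_iff₀ hh] at hN
  have hK0 := poissonKernel_circleMap_nonneg hw
  have hI1 := integrableOn_poissonKernel_mul hw hm hM
  have hI2 := integrableOn_poissonKernel_mul hw (m := fun _ => m t) aemeasurable_const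
    (fun _ => hM t)
  have hind : ∀ k : ℕ, Integrable ((closedBall t (2 ^ k * (1 - r))).indicator
      fun y => 4 * (1 / 4) ^ k / (1 - r) * ‖g y - g t‖) := fun k =>
    (integrable_indicator_iff measurableSet_closedBall).2 ((hφi _).const_mul _)
  conv_lhs => rw [← poissonIntegral_const hw (m t)]
  rw [poissonIntegral, poissonIntegral, ← mul_sub, ← integral_sub hI1 hI2, norm_mul,
    Real.norm_of_nonneg (inv_nonneg.2 Real.two_pi_pos.le), mul_assoc]
  refine mul_le_mul_of_nonneg_left ?_ (by positivity)
  calc ‖∫ θ in I, (poissonKernel 0 (circleMap 0 r t) (circleMap 0 1 θ) * m θ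
          - poissonKernel 0 (circleMap 0 r t) (circleMap 0 1 θ) * m t)‖
      ≤ ∫ θ in I, c * ∑ k ∈ Finset.range (N + 1),
          (closedBall t (2 ^ k * (1 - r))).indicator
            (fun y => 4 * (1 / 4) ^ k / (1 - r) * ‖g y - g t‖) θ := by
        refine norm_integral_le_of_norm_le
          ((integrable_finsetSum _ fun k _ => (hind k).integrableOn).const_mul c) ?_
        filter_upwards [ae_restrict_mem measurableSet_Ioc] with θ hθ
        have hgθ : m θ - m t = g θ - g t := by
          simp only [g, indicator_of_mem hθ, indicator_of_mem htI]
        have h1 : |θ - t| ≤ 2 ^ N * (1 - r) := by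
          refine le_trans (abs_le.2 ⟨?_, ?_⟩) hN.le <;> linarith [hθ.1, hθ.2, ht.1, ht.2]
        rw [← mul_sub, norm_mul, Real.norm_of_nonneg (hK0 θ), hgθ]
        calc poissonKernel 0 (circleMap 0 r t) (circleMap 0 1 θ) * ‖g θ - g t‖
            ≤ (c * ∑ k ∈ Finset.range (N + 1),
              if |θ - t| ≤ 2 ^ k * (1 - r) then 4 * (1 / 4) ^ k / (1 - r) else 0)
                * ‖g θ - g t‖ := by
              refine mul_le_mul_of_nonneg_right ((hker r hr θ hθ).trans ?_) (norm_nonneg _)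
              exact mul_le_mul_of_nonneg_left (div_sq_add_sq_le_sum_dyadic hh h1) hc.le
          _ = _ := by
              rw [mul_assoc, Finset.sum_mul]
              congr 1
              refine Finset.sum_congr rfl fun k _ => ?_
              by_cases hk : |θ - t| ≤ 2 ^ k * (1 - r)
              · rw [if_pos hk, indicator_of_mem (by rwa [mem_closedBall, Real.dist_eq])]
              · rw [if_neg hk, zero_mul,
                  indicator_of_notMem (by rwa [mem_closedBall, Real.dist_eq])]
    _ = c * ∑ k ∈ Finset.range (N + 1), ∫ θ in I,
          (closedBall t (2 ^ k * (1 - r))).indicator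
            (fun y => 4 * (1 / 4) ^ k / (1 - r) * ‖g y - g t‖) θ := by
        rw [integral_const_mul, integral_finsetSum _ fun k _ => (hind k).integrableOn]
    _ ≤ c * ∑ k ∈ Finset.range (N + 1), 8 * ((1 / 2) ^ k * A (2 ^ k * (1 - r))) := by
        refine mul_le_mul_of_nonneg_left (Finset.sum_le_sum fun k _ => ?_) hc.le
        calc _ ≤ ∫ θ, (closedBall t (2 ^ k * (1 - r))).indicator
                (fun y => 4 * (1 / 4) ^ k / (1 - r) * ‖g y - g t‖) θ := by
              refine setIntegral_le_integral (hind k) (Eventually.of_forall fun y => ?_)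
              exact indicator_nonneg (fun y _ => mul_nonneg (by positivity) (norm_nonneg _)) y
          _ = _ := by
              rw [integral_indicator measurableSet_closedBall, integral_const_mul,
                hAint _ (by positivity)]
              have : (1 / 4 : ℝ) ^ k * 2 ^ k = (1 / 2) ^ k := by
                rw [← mul_pow]; norm_num
              rw [← this]
              field_simp
              ring
    _ ≤ c * (8 * ∑' k : ℕ, (1 / 2) ^ k * A (2 ^ k * (1 - r))) := by
        rw [← Finset.mul_sum]
        refine mul_le_mul_of_nonneg_left (mul_le_mul_of_nonneg_left ?_ (by norm_num)) hc.le
        refine (Summable.of_norm_bounded hsummable (hbound _ hh)).sum_le_tsum _ fun k _ => ?_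
        exact mul_nonneg (by positivity) (hA0 _ (by positivity))
    _ = _ := by ring

/-! ### Radial limits of vector-valued bounded harmonic functions -/

/-- Radial upper bounds for the norm of a vector-valued bounded harmonic function.  If `m` dominates
the radial limits of `φ ∘ g` for every `φ` in a family of functionals that is norming for the values
of `g`, then `‖g‖` is at most the Poisson integral of `m`, whose radial limit is `m`. -/
theorem ae_eventually_norm_le_add {E : Type*} [NormedAddCommGroup E] [NormedSpace ℝ E] {g : ℂ → E}
    (hg : InnerProductSpace.HarmonicOnNhd g (ball 0 1))
    {C : ℝ} (hC : ∀ z ∈ ball (0 : ℂ) 1, ‖g z‖ ≤ C) {Φ : Set (StrongDual ℝ E)}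
    (hΦ : ∀ w ∈ ball (0 : ℂ) 1, ∀ c, (∀ φ ∈ Φ, φ (g w) ≤ c) → ‖g w‖ ≤ c) {m : ℝ → ℝ}
    (hm : AEMeasurable m (volume.restrict (Ioc 0 (2 * Real.pi)))) {M : ℝ} (hM : ∀ t, |m t| ≤ M)
    (hlim : ∀ φ ∈ Φ, ∀ᵐ t ∂(volume.restrict (Ioc 0 (2 * Real.pi))),
      ∃ b ≤ m t, Tendsto (fun r : ℝ => φ (g (circleMap 0 r t))) (𝓝[<] 1) (𝓝 b)) :
    ∀ᵐ t ∂(volume.restrict (Ioc 0 (2 * Real.pi))), ∀ ε > 0,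
      ∀ᶠ r : ℝ in 𝓝[<] 1, ‖g (circleMap 0 r t)‖ ≤ m t + ε := by
  have key : ∀ w ∈ ball (0 : ℂ) 1, ‖g w‖ ≤ poissonIntegral m w := fun w hw =>
    hΦ w hw _ fun φ hφ => le_poissonIntegral (hg.comp_CLM φ) (C := ‖φ‖ * C)
      (fun z hz => (φ.le_opNorm _).trans (by gcongr; exact hC z hz)) hm hM (hlim φ hφ) hw
  filter_upwards [ae_tendsto_poissonIntegral hm hM] with t ht ε hε
  filter_upwards [ht.eventually (gt_mem_nhds (lt_add_of_pos_right (m t) hε)),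
    eventually_mem_Ioo_half_one] with r h1 h2
  exact (key _ (circleMap_mem_unitBall (by linarith [h2.1]) h2.2 t)).trans h1.le

/-- A separable set is normed by a sequence of functionals of norm at most one: take norming
functionals at the points of a countable dense set. -/
lemma exists_norming_seq {E : Type*} [NormedAddCommGroup E] [NormedSpace ℝ E] {S : Set E}
    (hS : TopologicalSpace.IsSeparable S) :
    ∃ φ : ℕ → StrongDual ℝ E, (∀ k, ‖φ k‖ ≤ 1) ∧ ∀ s ∈ S, ∀ c, (∀ k, φ k s ≤ c) → ‖s‖ ≤ c := by
  obtain ⟨D, hD, hSD⟩ := hS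
  obtain ⟨d, hd⟩ := (hD.insert 0).exists_eq_range (insert_nonempty 0 D)
  choose φ hφ1 hφ2 using fun k => exists_dual_vector'' ℝ (d k)
  refine ⟨φ, hφ1, fun s hs c hc => le_of_forall_pos_le_add fun ε hε => ?_⟩
  obtain ⟨x, hx, hxs⟩ := Metric.mem_closure_iff.1 (hSD hs) (ε / 2) (half_pos hε)
  obtain ⟨k, rfl⟩ : x ∈ range d := hd ▸ mem_insert_of_mem 0 hx
  rw [dist_eq_norm] at hxs
  have h1 : ‖s‖ ≤ ‖d k‖ + ‖s - d k‖ := by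
    simpa using norm_add_le (d k) (s - d k)
  have h2 : φ k (d k) - φ k s ≤ ‖s - d k‖ := by
    rw [← map_sub, norm_sub_rev]
    exact (le_abs_self _).trans ((φ k).le_of_opNorm_le (hφ1 k) _ |>.trans (one_mul _).le)
  have h3 : φ k (d k) = ‖d k‖ := hφ2 k
  linarith [hc k]

/-- For bounded harmonic functions, weak radial convergence almost everywhere self-improves to
norm radial convergence almost everywhere.  The limit `b` lies in the separable closed span `S` of
the range, and for `z` in a countable dense subset of `S` the norm of `g - z` is radially dominated
by `‖b - z‖`. -/
theorem ae_tendsto_of_ae_tendsto_weak {E : Type*} [NormedAddCommGroup E] [NormedSpace ℝ E]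
    {g : ℂ → E} (hg : InnerProductSpace.HarmonicOnNhd g (ball 0 1))
    {C : ℝ} (hC : ∀ z ∈ ball (0 : ℂ) 1, ‖g z‖ ≤ C) {b : ℝ → E}
    (hb : ∀ᵐ t ∂(volume.restrict (Ioc 0 (2 * Real.pi))), ∀ φ : StrongDual ℝ E,
      Tendsto (fun r : ℝ => φ (g (circleMap 0 r t))) (𝓝[<] 1) (𝓝 (φ (b t)))) :
    ∀ᵐ t ∂(volume.restrict (Ioc 0 (2 * Real.pi))),
      Tendsto (fun r : ℝ => g (circleMap 0 r t)) (𝓝[<] 1) (𝓝 (b t)) := by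
  let S : Submodule ℝ E := (Submodule.span ℝ (g '' ball 0 1)).topologicalClosure
  have hSsep : TopologicalSpace.IsSeparable (S : Set E) :=
    (hg.continuousOn.isSeparable_image
      (TopologicalSpace.IsSeparable.of_separableSpace _)).span.closure
  have hgS : ∀ z ∈ ball (0 : ℂ) 1, g z ∈ S := fun z hz =>
    Submodule.le_topologicalClosure _ (Submodule.subset_span (mem_image_of_mem g hz))
  have hbC : ∀ᵐ t ∂(volume.restrict (Ioc 0 (2 * Real.pi))), ‖b t‖ ≤ C := by
    filter_upwards [hb] with t ht
    obtain ⟨φ, hφ1, hφ2⟩ := exists_dual_vector'' ℝ (b t)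
    have h := ht φ
    rw [hφ2] at h
    refine le_of_tendsto h ?_
    filter_upwards [eventually_mem_Ioo_half_one] with r hr
    exact (le_abs_self _).trans (((φ.le_of_opNorm_le hφ1 _).trans (one_mul _).le).trans
      (hC _ (circleMap_mem_unitBall (by linarith [hr.1]) hr.2 t)))
  have hbS : ∀ᵐ t ∂(volume.restrict (Ioc 0 (2 * Real.pi))), b t ∈ S := by
    filter_upwards [hb] with t ht
    by_contra hS
    obtain ⟨φ, u, hu1, hu2⟩ := geometric_hahn_banach_point_closed S.convex
      (Submodule.isClosed_topologicalClosure _) hS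
    refine hu1.not_ge (ge_of_tendsto (ht φ) ?_)
    filter_upwards [eventually_mem_Ioo_half_one] with r hr
    exact (hu2 _ (hgS _ (circleMap_mem_unitBall (by linarith [hr.1]) hr.2 t))).le
  obtain ⟨φ, hφ1, hφ2⟩ := exists_norming_seq hSsep
  obtain ⟨D, hDS, hD, hSD⟩ := hSsep.exists_countable_dense_subset
  have hC0 : 0 ≤ C := (norm_nonneg _).trans (hC 0 (by simp))
  have key : ∀ z ∈ D, ∀ᵐ t ∂(volume.restrict (Ioc 0 (2 * Real.pi))), ∀ ε > 0,
      ∀ᶠ r : ℝ in 𝓝[<] 1, ‖g (circleMap 0 r t) - z‖ ≤ ‖b t - z‖ + ε := by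
    intro z hz
    have hzS : z ∈ S := hDS hz
    have hbz : ∀ᵐ t ∂(volume.restrict (Ioc 0 (2 * Real.pi))), ‖b t - z‖ ≤ C + ‖z‖ := by
      filter_upwards [hbC] with t ht
      exact (norm_sub_le _ _).trans (by gcongr)
    -- the truncation makes the function bounded everywhere and does not change it almost everywhere
    let m : ℝ → ℝ := fun t => min ‖b t - z‖ (C + ‖z‖)
    have hmeq : ∀ᵐ t ∂(volume.restrict (Ioc 0 (2 * Real.pi))), m t = ‖b t - z‖ :=
      hbz.mono fun t ht => min_eq_left ht
    have hm : AEMeasurable m (volume.restrict (Ioc 0 (2 * Real.pi))) := by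
      have h1 : ∀ k, AEMeasurable (fun t => φ k (b t) - φ k z)
          (volume.restrict (Ioc 0 (2 * Real.pi))) := fun k =>
        (aemeasurable_of_tendsto_circleMap ((φ k).continuous.comp_continuousOn hg.continuousOn)
          (hb.mono fun t ht => ht (φ k))).sub_const _
      refine (AEMeasurable.iSup h1).congr ?_
      filter_upwards [hmeq, hbS] with t ht htS
      have h2 : ∀ k, φ k (b t) - φ k z ≤ ‖b t - z‖ := fun k => by
        rw [← map_sub]
        exact (le_abs_self _).trans (((φ k).le_of_opNorm_le (hφ1 k) _).trans (one_mul _).le)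
      rw [ht]
      refine le_antisymm (ciSup_le h2) (hφ2 _ (S.sub_mem htS hzS) _ fun k => ?_)
      rw [map_sub]
      exact le_ciSup (f := fun k => φ k (b t) - φ k z) ⟨_, forall_mem_range.2 h2⟩ k
    have h := ae_eventually_norm_le_add (g := fun w => g w - z)
      (hg.sub (InnerProductSpace.harmonicOnNhd_const z)) (C := C + ‖z‖)
      (fun w hw => (norm_sub_le _ _).trans (by gcongr; exact hC w hw)) (Φ := range φ)
      (fun w hw c hc => hφ2 _ (S.sub_mem (hgS w hw) hzS) c fun k => hc _ (mem_range_self k))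
      hm (M := C + ‖z‖)
      (fun t => by
        rw [abs_of_nonneg (le_min (norm_nonneg _) (by positivity))]
        exact min_le_right _ _)
      (by
        rintro _ ⟨k, rfl⟩
        filter_upwards [hb, hmeq] with t ht hmt
        refine ⟨φ k (b t - z), ?_, ?_⟩
        · rw [hmt]
          exact (le_abs_self _).trans (((φ k).le_of_opNorm_le (hφ1 k) _).trans (one_mul _).le)
        · simpa only [map_sub] using (ht (φ k)).sub_const (φ k z))
    filter_upwards [h, hmeq] with t ht hmt
    rwa [hmt] at ht
  filter_upwards [(ae_ball_iff hD).2 key, hbS] with t ht htS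
  rw [Metric.tendsto_nhds]
  intro ε hε
  obtain ⟨z, hz, hzt⟩ := Metric.mem_closure_iff.1 (hSD htS) (ε / 4) (by positivity)
  filter_upwards [ht z hz (ε / 4) (by positivity)] with r hr
  rw [dist_eq_norm] at hzt ⊢
  have := norm_sub_le_norm_sub_add_norm_sub (g (circleMap 0 r t)) z (b t)
  rw [norm_sub_rev z] at this
  linarith

/-! ### Operator-valued harmonic functions and weakly LUR operators -/

lemma MemHardyInfty.clm_comp {𝕜 : Type*} [RCLike 𝕜] {E F : Type*}
    [NormedAddCommGroup E] [NormedSpace 𝕜 E] [NormedAddCommGroup F] [NormedSpace 𝕜 F]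
    {f : ℂ → E} (hf : MemHardyInfty 𝕜 f) (L : E →L[𝕜] F) : MemHardyInfty 𝕜 (fun z => L (f z)) := by
  let : NormedSpace ℝ E := NormedSpace.restrictScalars ℝ 𝕜 E
  let : NormedSpace ℝ F := NormedSpace.restrictScalars ℝ 𝕜 F
  have : IsScalarTower ℝ 𝕜 E := RestrictScalars.isScalarTower ℝ 𝕜 E
  have : IsScalarTower ℝ 𝕜 F := RestrictScalars.isScalarTower ℝ 𝕜 F
  obtain ⟨h1, C, hC⟩ := hf
  exact ⟨h1.comp_CLM (L.restrictScalars ℝ), ‖L‖ * C,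
    fun z hz => (L.le_opNorm _).trans (by gcongr; exact hC z hz)⟩

section Operators

variable {𝕜 : Type*} [RCLike 𝕜] {X Y : Type*} [NormedAddCommGroup X] [NormedSpace 𝕜 X]
  [NormedAddCommGroup Y] [NormedSpace 𝕜 Y]

/-- A bounded family of operators into a complete space that converges at the points of a dense
sequence converges at every point. -/
lemma exists_tendsto_apply_of_denseRange [CompleteSpace Y] {ι : Type*} {l : Filter ι} [l.NeBot]
    {A : ι → X →L[𝕜] Y} {C : ℝ} (hC : ∀ᶠ i in l, ‖A i‖ ≤ C) {d : ℕ → X} (hd : DenseRange d)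
    (h : ∀ n, ∃ y, Tendsto (fun i => A i (d n)) l (𝓝 y)) (x : X) :
    ∃ y, Tendsto (fun i => A i x) l (𝓝 y) := by
  refine CompleteSpace.complete (f := map (fun i => A i x) l) ?_
  have hC0 : 0 ≤ C := by
    obtain ⟨i, hi⟩ := hC.exists
    exact (norm_nonneg _).trans hi
  refine Metric.cauchy_iff.2 ⟨inferInstance, fun ε hε => ?_⟩
  obtain ⟨n, hn⟩ := hd.exists_dist_lt x (ε := ε / (4 * (C + 1))) (by positivity)
  obtain ⟨y, hy⟩ := h n
  have hev : ∀ᶠ i in l, dist (A i x) y < ε / 2 := by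
    filter_upwards [hC, Metric.tendsto_nhds.1 hy (ε / 4) (by positivity)] with i h1 h2
    have h3 : dist (A i x) (A i (d n)) ≤ ε / 4 := by
      rw [dist_eq_norm, ← map_sub]
      rw [dist_eq_norm] at hn
      calc ‖A i (x - d n)‖ ≤ C * ‖x - d n‖ := (A i).le_of_opNorm_le h1 _
        _ ≤ (C + 1) * (ε / (4 * (C + 1))) := by gcongr; linarith
        _ = ε / 4 := by field_simp
    linarith [dist_triangle (A i x) (A i (d n)) y]
  refine ⟨ball y (ε / 2), hev, fun u hu v hv => ?_⟩
  have := dist_triangle_right u v y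
  rw [mem_ball] at hu hv
  linarith

lemma opNorm_le_of_denseRange {A : X →L[𝕜] Y} {c : ℝ} (hc : 0 ≤ c) {d : ℕ → X}
    (hd : DenseRange d) (h : ∀ n, ‖A (d n)‖ ≤ c * ‖d n‖) : ‖A‖ ≤ c :=
  A.opNorm_le_bound hc fun x =>
    hd.induction_on x (isClosed_le (by fun_prop) (by fun_prop)) h

/-- If operators converge strongly and their norms are asymptotically at most the norm of the
limit, then the norms converge: the operator norm is lower semicontinuous for the strong operator
topology. -/
lemma tendsto_opNorm_of_tendsto_apply {ι : Type*} {l : Filter ι} {A : ι → X →L[𝕜] Y}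
    {T : X →L[𝕜] Y} (h : ∀ x, Tendsto (fun i => A i x) l (𝓝 (T x)))
    (hle : ∀ ε > 0, ∀ᶠ i in l, ‖A i‖ ≤ ‖T‖ + ε) : Tendsto (fun i => ‖A i‖) l (𝓝 ‖T‖) := by
  refine tendsto_order.2 ⟨fun c hc => ?_, fun c hc => ?_⟩
  · by_cases hc0 : c < 0
    · exact Eventually.of_forall fun i => hc0.trans_le (norm_nonneg _)
    · rw [not_lt] at hc0
      have hx : ∃ x, c * ‖x‖ < ‖T x‖ := by
        by_contra! hx
        exact hc.not_ge (T.opNorm_le_bound hc0 hx)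
      obtain ⟨x, hx⟩ := hx
      filter_upwards [(h x).norm.eventually (lt_mem_nhds hx)] with i hi
      by_contra! hi2
      exact hi.not_ge ((A i).le_of_opNorm_le hi2 x)
  · filter_upwards [hle ((c - ‖T‖) / 2) (by linarith)] with i hi
    linarith

/-- The strong radial limits of a bounded harmonic family of operators.  A countable dense subset of
`X` needs only countably many exceptional null sets; boundedness gives the remaining vectors and the
continuity of the limit. -/
theorem exists_ae_strong_radial_limit [CompleteSpace Y] [TopologicalSpace.SeparableSpace X]
    (hY : HasRadonNikodymProperty 𝕜 Y) {f : ℂ → X →L[𝕜] Y} (hf : MemHardyInfty 𝕜 f) :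
    ∃ T : ℝ → X →L[𝕜] Y, ∀ᵐ t ∂(volume.restrict (Ioc 0 (2 * Real.pi))), ∀ x,
      Tendsto (fun r : ℝ => f (circleMap 0 r t) x) (𝓝[<] 1) (𝓝 (T t x)) := by
  obtain ⟨C, hC⟩ := hf.2
  suffices h : ∀ᵐ t ∂(volume.restrict (Ioc 0 (2 * Real.pi))), ∃ T : X →L[𝕜] Y, ∀ x,
      Tendsto (fun r : ℝ => f (circleMap 0 r t) x) (𝓝[<] 1) (𝓝 (T x)) by
    classical
    refine ⟨fun t => if h : ∃ T : X →L[𝕜] Y, ∀ x,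
      Tendsto (fun r : ℝ => f (circleMap 0 r t) x) (𝓝[<] 1) (𝓝 (T x)) then h.choose else 0, ?_⟩
    filter_upwards [h] with t ht
    rw [dif_pos ht]
    exact ht.choose_spec
  have hd : ∀ᵐ t ∂(volume.restrict (Ioc 0 (2 * Real.pi))), ∀ n, ∃ y,
      Tendsto (fun r : ℝ => f (circleMap 0 r t) (TopologicalSpace.denseSeq X n))
        (𝓝[<] 1) (𝓝 y) := by
    refine ae_all_iff.2 fun n => ?_
    have := hY _ (hf.clm_comp (ContinuousLinearMap.apply 𝕜 Y (TopologicalSpace.denseSeq X n)))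
    simpa [circleMap] using this
  filter_upwards [hd] with t ht
  have hfC : ∀ r ∈ Ioo (1 / 2 : ℝ) 1, ‖f (circleMap 0 r t)‖ ≤ C := fun r hr =>
    hC _ (circleMap_mem_unitBall (by linarith [hr.1]) hr.2 t)
  choose y hy using exists_tendsto_apply_of_denseRange
    (eventually_mem_Ioo_half_one.mono hfC) (TopologicalSpace.denseRange_denseSeq X) ht
  obtain ⟨s, hs⟩ := exists_seq_tendsto (𝓝[<] (1 : ℝ))
  obtain ⟨N, hN⟩ := eventually_atTop.1 (hs.eventually eventually_mem_Ioo_half_one)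
  refine ⟨ContinuousLinearMap.ofTendstoOfBoundedRange (l := atTop) y
    (fun n => f (circleMap 0 (s (n + N)) t)) ?_ ?_, hy⟩
  · exact tendsto_pi_nhds.2 fun x => ((hy x).comp hs).comp (tendsto_add_atTop_nat N)
  · refine isBounded_iff_forall_norm_le.2 ⟨C, ?_⟩
    rintro _ ⟨n, rfl⟩
    exact hfC _ (hN _ (by omega))

/-- The norms of a bounded harmonic family of operators are asymptotically at most the norm of the
strong radial limit.  The functionals `A ↦ ‖x‖⁻¹ ψ (A x)` with `‖ψ‖ ≤ 1` norm the space of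
operators, and separability of `X` makes the norm of the limit measurable. -/
theorem ae_eventually_opNorm_le_add [TopologicalSpace.SeparableSpace X]
    {f : ℂ → X →L[𝕜] Y} (hf : MemHardyInfty 𝕜 f) {T : ℝ → X →L[𝕜] Y}
    (hT : ∀ᵐ t ∂(volume.restrict (Ioc 0 (2 * Real.pi))), ∀ x,
      Tendsto (fun r : ℝ => f (circleMap 0 r t) x) (𝓝[<] 1) (𝓝 (T t x))) :
    ∀ᵐ t ∂(volume.restrict (Ioc 0 (2 * Real.pi))), ∀ ε > 0,
      ∀ᶠ r : ℝ in 𝓝[<] 1, ‖f (circleMap 0 r t)‖ ≤ ‖T t‖ + ε := by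
  let : NormedSpace ℝ Y := NormedSpace.restrictScalars ℝ 𝕜 Y
  have : IsScalarTower ℝ 𝕜 Y := RestrictScalars.isScalarTower ℝ 𝕜 Y
  let : NormedSpace ℝ (X →L[𝕜] Y) := NormedSpace.restrictScalars ℝ 𝕜 (X →L[𝕜] Y)
  have : IsScalarTower ℝ 𝕜 (X →L[𝕜] Y) := RestrictScalars.isScalarTower ℝ 𝕜 (X →L[𝕜] Y)
  obtain ⟨hharm, C, hC⟩ := hf
  have hC0 : 0 ≤ C := (norm_nonneg _).trans (hC 0 (by simp))
  have hTC : ∀ᵐ t ∂(volume.restrict (Ioc 0 (2 * Real.pi))), ‖T t‖ ≤ C := by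
    filter_upwards [hT] with t ht
    refine (T t).opNorm_le_bound hC0 fun x => le_of_tendsto (ht x).norm ?_
    filter_upwards [eventually_mem_Ioo_half_one] with r hr
    exact (f _).le_of_opNorm_le (hC _ (circleMap_mem_unitBall (by linarith [hr.1]) hr.2 t)) x
  -- the truncation makes the function bounded everywhere and does not change it almost everywhere
  let m : ℝ → ℝ := fun t => min ‖T t‖ C
  have hmeq : ∀ᵐ t ∂(volume.restrict (Ioc 0 (2 * Real.pi))), m t = ‖T t‖ :=
    hTC.mono fun t ht => min_eq_left ht
  have hm : AEMeasurable m (volume.restrict (Ioc 0 (2 * Real.pi))) := by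
    let d := TopologicalSpace.denseSeq X
    have h1 : ∀ n, AEMeasurable (fun t => ‖T t (d n)‖ / ‖d n‖)
        (volume.restrict (Ioc 0 (2 * Real.pi))) := fun n => by
      refine (aemeasurable_of_tendsto_circleMap (u := fun z => ‖f z (d n)‖) ?_ ?_).div_const _
      · exact ((ContinuousLinearMap.apply 𝕜 Y (d n)).continuous.comp_continuousOn
          hharm.continuousOn).norm
      · exact hT.mono fun t ht => (ht (d n)).norm
    refine (AEMeasurable.iSup h1).congr ?_
    filter_upwards [hmeq] with t ht
    have h2 : ∀ n, ‖T t (d n)‖ / ‖d n‖ ≤ ‖T t‖ := fun n => (T t).ratio_le_opNorm _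
    rw [ht]
    refine le_antisymm (ciSup_le h2) (opNorm_le_of_denseRange
      (Real.iSup_nonneg fun n => by positivity) (TopologicalSpace.denseRange_denseSeq X)
      fun n => ?_)
    by_cases h0 : d n = 0
    · have h0' : TopologicalSpace.denseSeq X n = 0 := h0
      simp [h0']
    · rw [← div_le_iff₀ (norm_pos_iff.2 h0)]
      exact le_ciSup (f := fun n => ‖T t (d n)‖ / ‖d n‖) ⟨_, forall_mem_range.2 h2⟩ n
  let ev : X → StrongDual ℝ Y → StrongDual ℝ (X →L[𝕜] Y) := fun x ψ =>
    ‖x‖⁻¹ • ψ.comp ((ContinuousLinearMap.apply 𝕜 Y x).restrictScalars ℝ)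
  have hev : ∀ x ψ A, ev x ψ A = ‖x‖⁻¹ * ψ (A x) := fun x ψ A => rfl
  have h := ae_eventually_norm_le_add hharm hC
    (Φ := {φ | ∃ x, ∃ ψ : StrongDual ℝ Y, ‖ψ‖ ≤ 1 ∧ φ = ev x ψ}) (m := m) ?_ hm (M := C) ?_ ?_
  · filter_upwards [h, hmeq] with t ht hmt
    rwa [hmt] at ht
  · intro w _ c hc
    have hc0 : 0 ≤ c := by
      simpa [hev] using hc (ev 0 0) ⟨0, 0, by simp, rfl⟩
    refine (f w).opNorm_le_bound hc0 fun x => ?_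
    obtain ⟨ψ, hψ1, hψ2⟩ := exists_dual_vector'' ℝ (f w x)
    have h1 := hc _ ⟨x, ψ, hψ1, rfl⟩
    rw [hev, hψ2] at h1
    by_cases h0 : x = 0
    · simp [h0]
    · rwa [inv_mul_le_iff₀ (norm_pos_iff.2 h0), mul_comm] at h1
  · intro t
    rw [abs_of_nonneg (le_min (norm_nonneg _) hC0)]
    exact min_le_right _ _
  · rintro _ ⟨x, ψ, hψ, rfl⟩
    filter_upwards [hT, hmeq] with t ht hmt
    refine ⟨‖x‖⁻¹ * ψ (T t x), ?_, ?_⟩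
    · rw [hmt]
      calc ‖x‖⁻¹ * ψ (T t x) ≤ ‖x‖⁻¹ * ‖T t x‖ := by
            gcongr
            exact (le_abs_self _).trans ((ψ.le_of_opNorm_le hψ _).trans (one_mul _).le)
        _ = ‖T t x‖ / ‖x‖ := by rw [div_eq_inv_mul]
        _ ≤ ‖T t‖ := (T t).ratio_le_opNorm x
    · exact ((ψ.continuous.tendsto _).comp (ht x)).const_mul _

/-- A weakly LUR operator on a space of operators maps a bounded sequence that converges strongly,
with norms asymptotically at most the norm of the limit, to a weakly convergent sequence. -/
lemma IsWeaklyLUROperator.tendsto_of_tendsto_apply {Z : Type*} [NormedAddCommGroup Z]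
    [NormedSpace 𝕜 Z] {V : (X →L[𝕜] Y) →L[𝕜] Z} (hV : IsWeaklyLUROperator V)
    {A : ℕ → X →L[𝕜] Y} {T : X →L[𝕜] Y} (hA : Bornology.IsBounded (range A))
    (h : ∀ x, Tendsto (fun n => A n x) atTop (𝓝 (T x)))
    (hle : ∀ ε > 0, ∀ᶠ n in atTop, ‖A n‖ ≤ ‖T‖ + ε) :
    Tendsto (fun n => toWeakSpace 𝕜 Z (V (A n))) atTop (𝓝 (toWeakSpace 𝕜 Z (V T))) := by
  refine hV T A hA ?_
  have h1 := tendsto_opNorm_of_tendsto_apply h hle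
  have h2 : Tendsto (fun n => ‖(2 : 𝕜)⁻¹ • (A n + T)‖) atTop (𝓝 ‖T‖) := by
    refine tendsto_opNorm_of_tendsto_apply (fun x => ?_) fun ε hε => ?_
    · have h3 : (2 : 𝕜)⁻¹ • (T x + T x) = T x := by
        rw [← two_smul 𝕜 (T x), inv_smul_smul₀ two_ne_zero]
      have h4 := ((h x).add_const (T x)).const_smul (2 : 𝕜)⁻¹
      rw [h3] at h4
      exact h4
    · filter_upwards [hle ε hε] with n hn
      have h3 : ‖(2 : 𝕜)⁻¹‖ = 2⁻¹ := by simp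
      rw [norm_smul, h3]
      linarith [norm_add_le (A n) T]
  have h3 := ((h1.pow 2).div_const 2).add_const (‖T‖ ^ 2 / 2) |>.sub (h2.pow 2)
  rwa [add_halves, sub_self] at h3

end Operators

/-- Weak convergence over `𝕜` gives convergence of the values of real-linear functionals. -/
lemma tendsto_realDual_of_tendsto_toWeakSpace {𝕜 : Type*} [RCLike 𝕜] {Z : Type*}
    [NormedAddCommGroup Z] [NormedSpace 𝕜 Z] [NormedSpace ℝ Z] [IsScalarTower ℝ 𝕜 Z]
    {ι : Type*} {l : Filter ι} {u : ι → Z} {z : Z}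
    (h : Tendsto (fun i => toWeakSpace 𝕜 Z (u i)) l (𝓝 (toWeakSpace 𝕜 Z z)))
    (φ : StrongDual ℝ Z) : Tendsto (fun i => φ (u i)) l (𝓝 (φ z)) := by
  have h1 := ((WeakBilin.eval_continuous (topDualPairing 𝕜 Z).flip
    (φ.extendRCLike (𝕜 := 𝕜))).tendsto (toWeakSpace 𝕜 Z z)).comp h
  have h2 := (RCLike.continuous_re.tendsto _).comp h1
  have h3 : ∀ v : Z, RCLike.re ((topDualPairing 𝕜 Z).flip (toWeakSpace 𝕜 Z v)
      (φ.extendRCLike (𝕜 := 𝕜))) = φ v := fun v => φ.re_extendRCLike_apply v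
  have h4 := h2.congr fun i => h3 (u i)
  rwa [h3] at h4

theorem mainTheorem2 {𝕜 : Type*} [RCLike 𝕜] {X Y Z : Type*}
    [NormedAddCommGroup X] [NormedSpace 𝕜 X] [CompleteSpace X]
    [NormedAddCommGroup Y] [NormedSpace 𝕜 Y] [CompleteSpace Y]
    [NormedAddCommGroup Z] [NormedSpace 𝕜 Z] [CompleteSpace Z]
    [TopologicalSpace.SeparableSpace X]
    (hY : HasRadonNikodymProperty 𝕜 Y)
    (V : (X →L[𝕜] Y) →L[𝕜] Z) (hV : IsWeaklyLUROperator V) :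
    IsRadonNikodymOperator V := by
  intro f hf
  let : NormedSpace ℝ Z := NormedSpace.restrictScalars ℝ 𝕜 Z
  have : IsScalarTower ℝ 𝕜 Z := RestrictScalars.isScalarTower ℝ 𝕜 Z
  obtain ⟨T, hT⟩ := exists_ae_strong_radial_limit hY hf
  obtain ⟨hVf, C', hC'⟩ := hf.clm_comp V
  obtain ⟨C, hC⟩ := hf.2
  have hweak : ∀ᵐ t ∂(volume.restrict (Ioc 0 (2 * Real.pi))), ∀ φ : StrongDual ℝ Z,
      Tendsto (fun r : ℝ => φ (V (f (circleMap 0 r t)))) (𝓝[<] 1) (𝓝 (φ (V (T t)))) := by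
    filter_upwards [hT, ae_eventually_opNorm_le_add hf hT] with t ht hle φ
    refine tendsto_of_seq_tendsto fun s hs => ?_
    obtain ⟨N, hN⟩ := eventually_atTop.1 (hs.eventually eventually_mem_Ioo_half_one)
    have hsN : Tendsto (fun n => s (n + N)) atTop (𝓝[<] 1) := hs.comp (tendsto_add_atTop_nat N)
    refine (tendsto_add_atTop_iff_nat N).1 (tendsto_realDual_of_tendsto_toWeakSpace (𝕜 := 𝕜) ?_ φ)
    refine hV.tendsto_of_tendsto_apply (A := fun n => f (circleMap 0 (s (n + N)) t)) ?_
      (fun x => (ht x).comp hsN) (fun ε hε => hsN.eventually (hle ε hε))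
    refine isBounded_iff_forall_norm_le.2 ⟨C, ?_⟩
    rintro _ ⟨n, rfl⟩
    have := hN (n + N) (by omega)
    exact hC _ (circleMap_mem_unitBall (by linarith [this.1]) this.2 t)
  filter_upwards [ae_tendsto_of_ae_tendsto_weak hVf hC' hweak] with t ht
  exact ⟨V (T t), by simpa [circleMap] using ht⟩
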